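/- Let $\Omega=\{0,1\}^{\mathbb N}$ be the Cantor space with the uniform Bernoulli measure $\mu$, and for a binary string $x$ let $\Omega_x\subset\Omega$ be the set of all infinite sequences with prefix $x$. A set is called $\mathbf 0'$-enumerable if it is the domain of a partial function computable with the halting-problem oracle $\mathbf 0'$; a $\mathbf 0'$-effectively open set is the union of the intervals $\Omega_x$ for all $x$ in some $\mathbf 0'$-enumerable set of strings. Let $\varepsilon>0$ be a rational number, let $U\subset\mathbb N\times\{0,1\}^*$ be a (computably) enumerable set, and let $U_n=\bigcup\{\Omega_x \mid (n,x)\in U\}$. Assume that $\mu(U_n)\le\varepsilon$ for every $n$, and that there is a total computable function $c$ such that every string $x$ with $(n,x)\in U$ has length at most $c(n)$. Then for every $\varepsilon'>\varepsilon$ there exists a $\mathbf 0'$-effectively open set $W$ with $\mu(W)\le\varepsilon'$ that contains $$\liminf_{n\to\infty} U_n=\bigcup_{N}\bigcap_{n\ge N} U_n .$$ Moreover, the construction is uniform: there is a single $\mathbf 0'$-enumerable relation $A$ such that, for all such $U$, $c$, $\varepsilon$ and every rational $\varepsilon'>\varepsilon$, and for every program $a$ enumerating $U$ and every program $b$ computing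 $c$, the set $W=\bigcup\{\Omega_x\mid (a,b,\varepsilon,\varepsilon',x)\in A\}$ has measure at most $\varepsilon'$ and contains $\liminf_{n\to\infty} U_n$. -/

import Mathlib

open MeasureTheory

namespace LimitComplexity

noncomputable section

/-- The Cantor space `Ω` of infinite binary sequences. -/
abbrev Cantor : Type := ℕ → Bool

/-- The interval `Ω_x`: all infinite sequences having the string `x` as a prefix. -/
def interval (x : List Bool) : Set Cantor :=
  {ω | ∀ i : Fin x.length, ω i = x.get i}

/-- The open set generated by a set of strings: the union of the corresponding intervals. -/
def openOf (A : Set (List Bool)) : Set Cantor :=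
  ⋃ x ∈ A, interval x

/-- The uniform Bernoulli measure on the Cantor space (independent fair coin tosses). -/
def coinMeasure : Measure Cantor :=
  Measure.infinitePi fun _ : ℕ => (PMF.uniformOfFintype Bool).toMeasure

open Classical in
/-- The oracle `0'`: the characteristic function of the universal enumerable set
`{⟨e, n⟩ | the e-th program halts on input n}`. -/
def zeroJump : ℕ →. ℕ := fun k =>
  Part.some (if ((Denumerable.ofNat Nat.Partrec.Code k.unpair.1).eval k.unpair.2).Dom
    then 1 else 0)

/-- A set is `0'`-enumerable if it is the domain of a partial function that is computable with
oracle `0'`. -/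
def ZeroJumpEnumerable {α : Type} [Primcodable α] (A : Set α) : Prop :=
  RecursiveIn {zeroJump} fun a : α => Part.assert (a ∈ A) fun _ => Part.some ()

/-- `0'`-effectively open sets: unions of `0'`-enumerable families of intervals. -/
def ZeroJumpEffectivelyOpen (W : Set Cantor) : Prop :=
  ∃ A : Set (List Bool), ZeroJumpEnumerable A ∧ W = openOf A

/-- The set `U_n = ⋃ {Ω_x | (n, x) ∈ U}`. -/
def level (U : Set (ℕ × List Bool)) (n : ℕ) : Set Cantor :=
  openOf {x | (n, x) ∈ U}

/-- The limit inferior of a sequence of sets: `⋃_N ⋂_{n ≥ N} S_n`. -/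
def setLiminf (S : ℕ → Set Cantor) : Set Cantor :=
  ⋃ N : ℕ, ⋂ n ≥ N, S n

/-- The program `a` enumerates `U`: it halts exactly on the (codes of) elements of `U`. -/
def Enumerates (a : Nat.Partrec.Code) (U : Set (ℕ × List Bool)) : Prop :=
  ∀ p : ℕ × List Bool, p ∈ U ↔ (a.eval (Encodable.encode p)).Dom

/-- The program `b` computes the total function `c`. -/
def Computes (b : Nat.Partrec.Code) (c : ℕ → ℕ) : Prop :=
  ∀ n : ℕ, b.eval n = Part.some (c n)

/-- Nonnegative rational numbers as inputs of algorithms: the pair `(k, d)` represents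
`k / (d + 1)`. -/
def ratOf (q : ℕ × ℕ) : ℚ := (q.1 : ℚ) / ((q.2 : ℚ) + 1)

/-- The inputs of a uniform construction: a program enumerating a family of sets of strings,
a program computing a bound on their lengths, and two rational numbers `ε` and `ε'`. -/
abbrev Input : Type := (Nat.Partrec.Code × Nat.Partrec.Code) × ((ℕ × ℕ) × (ℕ × ℕ))

end

end LimitComplexity

namespace LimitComplexity
open Nat.Partrec (Code)
open Encodable

/-! Build W as an increasing union of open sets [w i], each generated by a finite list `w i`, with
the invariant μ(U_n ∪ [w i]) ≤ `stageBound e e' i` for all n ≥ i. These bounds start at ε, increase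
strictly and never exceed ε', so μ(W) ≤ ε'. Stage i adds strings so that some finite intersection
U_i ∩ … ∩ U_m is covered; it contains ⋂_{n ≥ i} U_n, hence W contains the limit inferior.

Such a stage always exists (`exists_extension`). The sets B_m = U_i ∩ … ∩ U_m decrease to K = ⋂_{n ≥
i} U_n, and K already lies in every U_n with n ≥ i. Adding B_m therefore costs at most μ(B_m \ K),
which tends to 0 and does not depend on n. The length bound makes B_m clopen, so a finite list
generates it.

The oracle can find such a stage: a bad candidate is exposed by finite evidence (`primrec_refutes`,
`not_exists_refutes_iff`), so being good is co-enumerable. `exists_recursiveIn_iteration` iterates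
the search with the input as a parameter, which gives uniformity. -/

/-! ### Prefixes, intervals and the coin-tossing measure -/

/-- The first `k` bits of an infinite sequence. -/
def initial (ω : Cantor) (k : ℕ) : List Bool := (List.range k).map ω

@[simp] theorem length_initial (ω : Cantor) (k : ℕ) : (initial ω k).length = k := by
  simp [initial]

theorem take_initial (ω : Cantor) {j k : ℕ} (h : j ≤ k) :
    (initial ω k).take j = initial ω j := by
  simp [initial, ← List.map_take, List.take_range, h]

theorem mem_interval_iff {ω : Cantor} {x : List Bool} :
    ω ∈ interval x ↔ initial ω x.length = x := by
  constructor
  · intro h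
    apply List.ext_getElem (by simp)
    intro i h1 h2
    simpa [initial] using h ⟨i, h2⟩
  · intro h i
    have h2 := congrArg (fun l => l[(i : ℕ)]?) h
    simpa [initial] using h2

theorem mem_openOf_iff {ω : Cantor} {S : Set (List Bool)} :
    ω ∈ openOf S ↔ ∃ k, initial ω k ∈ S := by
  simp only [openOf, Set.mem_iUnion, mem_interval_iff, exists_prop]
  constructor
  · rintro ⟨x, hx, h⟩
    exact ⟨x.length, by rwa [h]⟩
  · rintro ⟨k, hk⟩
    exact ⟨_, hk, by simp⟩

/-- The sequence that continues a string by zeros. -/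
def padding (y : List Bool) : Cantor := fun i => y.getD i false

theorem initial_padding (y : List Bool) : initial (padding y) y.length = y := by
  apply List.ext_getElem (by simp)
  intro i h1 h2
  simp [initial, padding, h2]

theorem measurableSet_interval (x : List Bool) : MeasurableSet (interval x) := by
  have : interval x = ⋂ i : Fin x.length, (fun ω : Cantor => ω i) ⁻¹' {x.get i} := by
    ext ω; simp [interval]
  rw [this]
  exact MeasurableSet.iInter fun i => measurable_pi_apply _ (measurableSet_singleton _)

theorem measurableSet_openOf (S : Set (List Bool)) : MeasurableSet (openOf S) :=
  MeasurableSet.biUnion (Set.to_countable S) fun x _ => measurableSet_interval x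

instance : IsProbabilityMeasure coinMeasure := by
  unfold coinMeasure; infer_instance

theorem coinMeasure_interval (x : List Bool) :
    coinMeasure (interval x) = ENNReal.ofReal ((2 : ℝ) ^ x.length)⁻¹ := by
  -- Only coordinates below `x.length` are constrained, so the default of `getD` is never read.
  have : interval x = Set.pi (Finset.range x.length : Set ℕ) fun i => {x.getD i false} := by
    ext ω
    simp only [interval, Set.mem_ofPred_eq, Set.mem_pi, Finset.coe_range, Set.mem_Iio,
      Set.mem_singleton_iff]
    constructor
    · intro h i hi
      simpa [hi] using h ⟨i, hi⟩
    · intro h i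
      simpa using h i i.2
  rw [this, coinMeasure, Measure.infinitePi_pi _ (fun _ _ => measurableSet_singleton _)]
  simp only [PMF.toMeasure_apply_singleton _ _ (measurableSet_singleton _),
    PMF.uniformOfFintype_apply, Fintype.card_bool, Finset.prod_const, Finset.card_range]
  rw [ENNReal.ofReal_inv_of_pos (by positivity), ENNReal.ofReal_pow (by norm_num), ENNReal.inv_pow]
  norm_num

/-- The set of sequences whose first `L` bits form a string of a finite set. -/
theorem coinMeasure_initial_mem (L : ℕ) (S : Finset (List Bool)) (hS : ∀ y ∈ S, y.length = L) :
    coinMeasure {ω | initial ω L ∈ S} = ENNReal.ofReal (S.card / 2 ^ L) := by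
  have : {ω : Cantor | initial ω L ∈ S} = ⋃ y ∈ S, interval y := by
    ext ω
    simp only [Set.mem_ofPred_eq, Set.mem_iUnion, mem_interval_iff, exists_prop]
    constructor
    · intro h
      exact ⟨_, h, by simp⟩
    · rintro ⟨y, hy, h⟩
      rw [hS y hy] at h
      rwa [h]
  rw [this, measure_biUnion_finset _ fun y _ => measurableSet_interval y]
  · rw [Finset.sum_congr rfl fun y hy => by rw [coinMeasure_interval, hS y hy]]
    rw [Finset.sum_const, nsmul_eq_mul, div_eq_mul_inv, ENNReal.ofReal_mul (by positivity),
      ENNReal.ofReal_natCast]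
  · intro y hy z hz hyz
    refine Set.disjoint_left.2 fun ω h1 h2 => hyz ?_
    rw [mem_interval_iff] at h1 h2
    rw [hS y hy] at h1
    rw [hS z hz] at h2
    rw [← h1, h2]

/-- All strings of a given length. -/
def allStrings (L : ℕ) : List (List Bool) :=
  L.rec [[]] fun _ ls => ls.flatMap fun x => [false :: x, true :: x]

theorem allStrings_succ (L : ℕ) :
    allStrings (L + 1) = (allStrings L).flatMap fun x => [false :: x, true :: x] := rfl

theorem mem_allStrings {L : ℕ} {y : List Bool} : y ∈ allStrings L ↔ y.length = L := by
  induction L generalizing y with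
  | zero => simp [allStrings]
  | succ L ih =>
    rw [allStrings_succ, List.mem_flatMap]
    cases y with
    | nil => simp
    | cons b y =>
      cases b <;> simp [ih]

theorem nodup_allStrings (L : ℕ) : (allStrings L).Nodup := by
  induction L with
  | zero => simp [allStrings]
  | succ L ih =>
    rw [allStrings_succ, List.nodup_flatMap]
    refine ⟨by simp, ih.imp ?_⟩
    intro a b hab
    simp [Function.onFun, hab.symm]

/-- Turns the measure of an event determined by `L` bits into a count of strings, so that measure
inequalities become arithmetic. -/
theorem coinMeasure_filter_allStrings (L : ℕ) (p : List Bool → Prop) [DecidablePred p] :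
    coinMeasure {ω | p (initial ω L)} =
      ENNReal.ofReal (((allStrings L).filter fun y => p y).length / 2 ^ L) := by
  have h := coinMeasure_initial_mem L ((allStrings L).filter fun y => p y).toFinset
    (by simp +contextual [mem_allStrings])
  rw [List.toFinset_card_of_nodup ((nodup_allStrings L).filter _)] at h
  rw [← h]
  congr 1
  ext ω
  simp [mem_allStrings]

/-! ### Primitive recursive tests for finite evidence -/

theorem primrecPred_forall_mem {α β : Type*} [Primcodable α] [Primcodable β] {f : α → List β}
    {p : α → β → Prop} (hf : Primrec f) (hp : PrimrecRel p) :
    PrimrecPred fun a => ∀ b ∈ f a, p a b :=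
  hp.swap.forall_mem_list.comp hf Primrec.id

theorem primrecPred_exists_mem {α β : Type*} [Primcodable α] [Primcodable β] {f : α → List β}
    {p : α → β → Prop} (hf : Primrec f) (hp : PrimrecRel p) :
    PrimrecPred fun a => ∃ b ∈ f a, p a b :=
  hp.swap.exists_mem_list.comp hf Primrec.id

theorem primrecPred_forall_lt {α : Type*} [Primcodable α] {f : α → ℕ}
    {p : α → ℕ → Prop} (hf : Primrec f) (hp : PrimrecRel p) :
    PrimrecPred fun a => ∀ b < f a, p a b :=
  (primrecPred_forall_mem (Primrec.list_range.comp hf) hp).of_eq fun _ => by simp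

theorem primrecPred_exists_lt {α : Type*} [Primcodable α] {f : α → ℕ}
    {p : α → ℕ → Prop} (hf : Primrec f) (hp : PrimrecRel p) :
    PrimrecPred fun a => ∃ b < f a, p a b :=
  (primrecPred_exists_mem (Primrec.list_range.comp hf) hp).of_eq fun _ => by simp

/-- Some string of the list `v` is a prefix of `y`. -/
def Covers (v : List (List Bool)) (y : List Bool) : Prop := ∃ x ∈ v, y.take x.length = x

/-- After `t` steps the program `a` has enumerated a pair `(n, x)` with `x` a prefix of `y`. -/
def Appears (t : ℕ) (a : Code) (n : ℕ) (y : List Bool) : Prop :=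
  ∃ j < y.length + 1, (Code.evaln t a (encode (n, y.take j))).isSome

instance (v : List (List Bool)) : DecidablePred (Covers v) :=
  fun _ => inferInstanceAs (Decidable (∃ _ ∈ _, _))

instance (t : ℕ) (a : Code) (n : ℕ) : DecidablePred (Appears t a n) :=
  fun y => inferInstanceAs (Decidable (∃ j < y.length + 1,
    (Code.evaln t a (encode (n, y.take j))).isSome = true))

theorem primrec_covers : PrimrecRel Covers := by
  refine PrimrecPred.primrecRel (p := fun q : List (List Bool) × List Bool => Covers q.1 q.2) ?_
  refine primrecPred_exists_mem Primrec.fst ?_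
  exact Primrec.eq.comp (Primrec.list_take.comp (Primrec.list_length.comp Primrec.snd)
    (Primrec.snd.comp Primrec.fst)) Primrec.snd

theorem primrec_appears :
    PrimrecPred fun q : (ℕ × Code × ℕ) × List Bool => Appears q.1.1 q.1.2.1 q.1.2.2 q.2 := by
  refine primrecPred_exists_lt (Primrec.succ.comp (Primrec.list_length.comp Primrec.snd)) ?_
  refine Primrec.primrecPred (Primrec.of_eq (f := fun r : ((ℕ × Code × ℕ) × List Bool) × ℕ =>
    (Code.evaln r.1.1.1 r.1.1.2.1 (encode (r.1.1.2.2, r.1.2.take r.2))).isSome) ?_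
    fun _ => Bool.decide_eq_true.symm)
  refine Primrec.option_isSome.comp (Code.primrec_evaln.comp
    (Primrec.pair (Primrec.pair ?_ ?_) (Primrec.encode.comp (Primrec.pair ?_ ?_))))
  · exact Primrec.fst.comp (Primrec.fst.comp Primrec.fst)
  · exact Primrec.fst.comp (Primrec.snd.comp (Primrec.fst.comp Primrec.fst))
  · exact Primrec.snd.comp (Primrec.snd.comp (Primrec.fst.comp Primrec.fst))
  · exact Primrec.list_take.comp Primrec.snd (Primrec.snd.comp Primrec.fst)

theorem primrec_allStrings : Primrec allStrings := by
  refine Primrec.nat_rec₁ _ ?_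
  refine Primrec.list_flatMap Primrec.snd ?_
  refine Primrec.list_cons.comp (Primrec.list_cons.comp (Primrec.const _) Primrec.snd)
    (Primrec.list_cons.comp (Primrec.list_cons.comp (Primrec.const _) Primrec.snd)
      (Primrec.const _))

theorem primrec_two_pow : Primrec fun L : ℕ => 2 ^ L :=
  (Primrec.nat_rec₁ (f := fun _ p => 2 * p) 1 (Primrec.nat_double.comp Primrec.snd)).of_eq
    fun n => by induction n with
      | zero => rfl
      | succ n ih => simp [pow_succ, mul_comm, ← ih]

/-- The number of strings of length `L` that have a prefix in the list `v` or in the `n`-th set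
of strings enumerated by `a` within `t` steps. -/
def countCovered (a : Code) (v : List (List Bool)) (n L t : ℕ) : ℕ :=
  ((allStrings L).filter fun y => Appears t a n y ∨ Covers v y).length

theorem primrec_countCovered :
    Primrec fun q : (Code × List (List Bool)) × ℕ × ℕ × ℕ =>
      countCovered q.1.1 q.1.2 q.2.1 q.2.2.1 q.2.2.2 := by
  have hR : PrimrecRel fun (y : List Bool) (q : (Code × List (List Bool)) × ℕ × ℕ × ℕ) =>
      Appears q.2.2.2 q.1.1 q.2.1 y ∨ Covers q.1.2 y := by
    refine PrimrecPred.or ?_ ?_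
    · refine primrec_appears.comp (f := fun r : List Bool × (Code × List (List Bool)) × ℕ × ℕ × ℕ =>
        ((r.2.2.2.2, r.2.1.1, r.2.2.1), r.1)) ?_
      refine Primrec.pair (Primrec.pair ?_ (Primrec.pair ?_ ?_)) Primrec.fst
      · exact Primrec.snd.comp (Primrec.snd.comp (Primrec.snd.comp Primrec.snd))
      · exact Primrec.fst.comp (Primrec.fst.comp Primrec.snd)
      · exact Primrec.fst.comp (Primrec.snd.comp Primrec.snd)
    · exact primrec_covers.comp (Primrec.snd.comp (Primrec.fst.comp Primrec.snd)) Primrec.fst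
  refine Primrec.list_length.comp (hR.listFilter.comp
    (primrec_allStrings.comp (Primrec.fst.comp (Primrec.snd.comp Primrec.snd))) Primrec.id)

/-- The string `y` witnesses within `t` steps that the intersection of the sets number `i`, …, `m`
enumerated by `a` is not included in the open set generated by `v`. -/
def Escapes (a : Code) (i m : ℕ) (v : List (List Bool)) (t : ℕ) (y : List Bool) : Prop :=
  (∀ n < m + 1, n < i ∨ Appears t a n y) ∧ ∀ x ∈ v, x.length ≤ y.length ∧ y.take x.length ≠ x

/-- At level `L` and within `t` steps it turns out that the union of the `n`-th set enumerated by
`a` with the open set generated by `v` has measure greater than `(ε + i ε') / (i + 1)`. -/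
def Exceeds (a : Code) (e e' : ℕ × ℕ) (i : ℕ) (v : List (List Bool)) (n L t : ℕ) : Prop :=
  (e.1 * (e'.2 + 1) + i * (e'.1 * (e.2 + 1))) * 2 ^ L <
    countCovered a v n L t * ((i + 1) * ((e.2 + 1) * (e'.2 + 1)))

/-- A state of the construction: the input, the number of the stage, and the strings enumerated
so far. -/
abbrev Stage : Type := Input × ℕ × List (List Bool)

/-- Evidence, found within finitely many steps, against extending the state `s` by the strings of
`D.1` so as to cover the intersection of the sets with numbers from `s.2.1` to `D.2`. -/
def Refutes (s : Stage) (D : List (List Bool) × ℕ) (r : (ℕ × List Bool) × ℕ × ℕ) : Prop :=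
  Escapes s.1.1.1 s.2.1 D.2 (D.1 ++ s.2.2) r.1.1 r.1.2 ∨
    s.2.1 < r.2.1 + 1 ∧
      Exceeds s.1.1.1 s.1.2.1 s.1.2.2 (s.2.1 + 1) (D.1 ++ s.2.2) r.2.1 r.2.2 r.1.1

theorem primrec_escapes :
    PrimrecPred fun q : (Code × ℕ × ℕ) × List (List Bool) × ℕ × List Bool =>
      Escapes q.1.1 q.1.2.1 q.1.2.2 q.2.1 q.2.2.1 q.2.2.2 := by
  refine PrimrecPred.and ?_ ?_
  · refine primrecPred_forall_lt
      (Primrec.succ.comp (Primrec.snd.comp (Primrec.snd.comp Primrec.fst))) ?_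
    refine PrimrecPred.or ?_ ?_
    · exact Primrec.nat_lt.comp Primrec.snd
        (Primrec.fst.comp (Primrec.snd.comp (Primrec.fst.comp Primrec.fst)))
    · refine primrec_appears.comp
        (f := fun r : ((Code × ℕ × ℕ) × List (List Bool) × ℕ × List Bool) × ℕ =>
          ((r.1.2.2.1, r.1.1.1, r.2), r.1.2.2.2)) ?_
      refine Primrec.pair (Primrec.pair ?_ (Primrec.pair ?_ Primrec.snd)) ?_
      · exact Primrec.fst.comp (Primrec.snd.comp (Primrec.snd.comp Primrec.fst))
      · exact Primrec.fst.comp (Primrec.fst.comp Primrec.fst)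
      · exact Primrec.snd.comp (Primrec.snd.comp (Primrec.snd.comp Primrec.fst))
  · refine primrecPred_forall_mem (Primrec.fst.comp Primrec.snd) ?_
    have hy : Primrec fun r : ((Code × ℕ × ℕ) × List (List Bool) × ℕ × List Bool) × List Bool =>
        r.1.2.2.2 := Primrec.snd.comp (Primrec.snd.comp (Primrec.snd.comp Primrec.fst))
    have hx : Primrec fun r : ((Code × ℕ × ℕ) × List (List Bool) × ℕ × List Bool) × List Bool =>
        r.2.length := Primrec.list_length.comp Primrec.snd
    exact PrimrecPred.and (Primrec.nat_le.comp hx (Primrec.list_length.comp hy))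
      (PrimrecPred.not (Primrec.eq.comp (Primrec.list_take.comp hx hy) Primrec.snd))

/-- With denominators cleared, the inequality compares two natural numbers. -/
theorem primrec_exceeds :
    PrimrecPred fun q : ((Code × List (List Bool)) × ℕ × ℕ × ℕ) × ((ℕ × ℕ) × (ℕ × ℕ)) × ℕ =>
      Exceeds q.1.1.1 q.2.1.1 q.2.1.2 q.2.2 q.1.1.2 q.1.2.1 q.1.2.2.1 q.1.2.2.2 := by
  let T := ((Code × List (List Bool)) × ℕ × ℕ × ℕ) × ((ℕ × ℕ) × (ℕ × ℕ)) × ℕ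
  have he : Primrec fun q : T => q.2.1.1.1 :=
    Primrec.fst.comp (Primrec.fst.comp (Primrec.fst.comp Primrec.snd))
  have he' : Primrec fun q : T => q.2.1.2.1 :=
    Primrec.fst.comp (Primrec.snd.comp (Primrec.fst.comp Primrec.snd))
  have hd : Primrec fun q : T => q.2.1.1.2 + 1 :=
    Primrec.succ.comp (Primrec.snd.comp (Primrec.fst.comp (Primrec.fst.comp Primrec.snd)))
  have hd' : Primrec fun q : T => q.2.1.2.2 + 1 :=
    Primrec.succ.comp (Primrec.snd.comp (Primrec.snd.comp (Primrec.fst.comp Primrec.snd)))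
  have hi : Primrec fun q : T => q.2.2 := Primrec.snd.comp Primrec.snd
  have hL : Primrec fun q : T => 2 ^ q.1.2.2.1 :=
    primrec_two_pow.comp (Primrec.fst.comp (Primrec.snd.comp (Primrec.snd.comp Primrec.fst)))
  exact Primrec.nat_lt.comp
    (Primrec.nat_mul.comp (Primrec.nat_add.comp (Primrec.nat_mul.comp he hd')
      (Primrec.nat_mul.comp hi (Primrec.nat_mul.comp he' hd))) hL)
    (Primrec.nat_mul.comp (primrec_countCovered.comp Primrec.fst)
      (Primrec.nat_mul.comp (Primrec.succ.comp hi) (Primrec.nat_mul.comp hd hd')))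

theorem primrec_refutes :
    PrimrecPred fun q : (Stage × List (List Bool) × ℕ) × (ℕ × List Bool) × ℕ × ℕ =>
      Refutes q.1.1 q.1.2 q.2 := by
  let T := (Stage × List (List Bool) × ℕ) × (ℕ × List Bool) × ℕ × ℕ
  have hs : Primrec fun q : T => q.1.1 := Primrec.fst.comp Primrec.fst
  have hD : Primrec fun q : T => q.1.2 := Primrec.snd.comp Primrec.fst
  have ha : Primrec fun q : T => q.1.1.1.1.1 :=
    Primrec.fst.comp (Primrec.fst.comp (Primrec.fst.comp hs))
  have hi : Primrec fun q : T => q.1.1.2.1 := Primrec.fst.comp (Primrec.snd.comp hs)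
  have hv : Primrec fun q : T => q.1.2.1 ++ q.1.1.2.2 :=
    Primrec.list_append.comp (Primrec.fst.comp hD) (Primrec.snd.comp (Primrec.snd.comp hs))
  have ht : Primrec fun q : T => q.2.1.1 := Primrec.fst.comp (Primrec.fst.comp Primrec.snd)
  have hy : Primrec fun q : T => q.2.1.2 := Primrec.snd.comp (Primrec.fst.comp Primrec.snd)
  have hn : Primrec fun q : T => q.2.2.1 := Primrec.fst.comp (Primrec.snd.comp Primrec.snd)
  have hL : Primrec fun q : T => q.2.2.2 := Primrec.snd.comp (Primrec.snd.comp Primrec.snd)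
  refine PrimrecPred.or ?_ (PrimrecPred.and ?_ ?_)
  · exact primrec_escapes.comp
      (Primrec.pair (Primrec.pair ha (Primrec.pair hi (Primrec.snd.comp hD)))
        (Primrec.pair hv (Primrec.pair ht hy)))
  · exact Primrec.nat_lt.comp hi (Primrec.succ.comp hn)
  · exact primrec_exceeds.comp
      (Primrec.pair (Primrec.pair (Primrec.pair ha hv) (Primrec.pair hn (Primrec.pair hL ht)))
        (Primrec.pair (Primrec.snd.comp (Primrec.fst.comp hs)) (Primrec.succ.comp hi)))

/-! ### Enumerability and search with the halting oracle -/

theorem rfind_decide_dom (p : ℕ → Prop) [DecidablePred p] :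
    (Nat.rfind fun n => Part.some (decide (p n))).Dom ↔ ∃ n, p n := by
  refine Nat.rfind_dom.trans (exists_congr fun n => ?_)
  simp

theorem rePred_exists {α β : Type*} [Primcodable α] [Primcodable β] {p : α → β → Prop}
    (hp : PrimrecRel p) : REPred fun a => ∃ b, p a b := by
  classical
  have h1 : PrimrecPred fun q : α × ℕ => ∃ b ∈ (decode q.2 : Option β).toList, p q.1 b := by
    refine primrecPred_exists_mem
      (Primrec.optionToList.comp (Primrec.decode.comp Primrec.snd)) ?_
    exact hp.comp (Primrec.fst.comp Primrec.fst) Primrec.snd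
  have h2 : Partrec fun a : α => Nat.rfind fun n =>
      Part.some (decide (∃ b ∈ (decode n : Option β).toList, p a b)) :=
    Partrec.rfind h1.decide.to_comp.partrec
  refine h2.dom_re.of_eq fun a => ?_
  refine (rfind_decide_dom _).trans ?_
  simp only [Option.mem_toList]
  constructor
  · rintro ⟨n, b, -, h⟩
    exact ⟨b, h⟩
  · rintro ⟨b, h⟩
    exact ⟨encode b, b, by simp, h⟩

theorem exists_code_of_rePred {α : Type*} [Primcodable α] {p : α → Prop} (hp : REPred p) :
    ∃ e : Code, ∀ a, (e.eval (encode a)).Dom ↔ p a := by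
  obtain ⟨e, he⟩ := Code.exists_code.1 hp
  refine ⟨e, fun a => ?_⟩
  rw [he]
  simp [Part.assert]

theorem recursiveIn_comp_some {O : Set (ℕ →. ℕ)} {f : ℕ →. ℕ} {g : ℕ → ℕ}
    (hf : Nat.RecursiveIn O f) (hg : Computable g) : Nat.RecursiveIn O fun n => f (g n) := by
  have hg' : Nat.RecursiveIn O fun n => Part.some (g n) :=
    Nat.Partrec.recursiveIn (Partrec.nat_iff.1 hg.partrec)
  exact (hf.comp hg').of_eq fun n => Part.bind_some _ _

theorem recursiveIn_bind_pair {O : Set (ℕ →. ℕ)} {f : ℕ →. ℕ} {g : ℕ → ℕ → ℕ}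
    (hf : Nat.RecursiveIn O f) (hg : Computable₂ g) :
    Nat.RecursiveIn O fun n => (f n).map fun k => g n k := by
  have hg' : Nat.RecursiveIn O fun p => Part.some (g p.unpair.1 p.unpair.2) :=
    Nat.Partrec.recursiveIn (Partrec.nat_iff.1
      (hg.comp (Computable.fst.comp Computable.unpair)
        (Computable.snd.comp Computable.unpair)).partrec)
  have hid : Nat.RecursiveIn O fun n => Part.some n :=
    Nat.Partrec.recursiveIn (Partrec.nat_iff.1 Computable.id.partrec)
  refine (hg'.comp (hid.pair hf)).of_eq fun n => ?_
  simp [Seq.seq, ← Part.bind_some_eq_map, Part.bind_assoc]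

/-- Unbounded search for a number with a co-enumerable property is possible with oracle `0'`. -/
theorem recursiveIn_zeroJump_search {p : ℕ → ℕ → Prop} [∀ m k, Decidable (p m k)]
    (hp : REPred fun q : ℕ × ℕ => p q.1 q.2) :
    Nat.RecursiveIn {zeroJump} fun m => Nat.rfind fun k => Part.some (decide ¬ p m k) := by
  obtain ⟨e, he⟩ := exists_code_of_rePred hp
  have h : Nat.RecursiveIn {zeroJump} fun m => zeroJump (Nat.pair (encode e) m) :=
    recursiveIn_comp_some (Nat.RecursiveIn.oracle _ rfl)
      (Primrec₂.natPair.comp (Primrec.const _) Primrec.id).to_comp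
  -- Minimisation stops at the value 0, which the oracle returns exactly on divergence, that is,
  -- where `p m k` fails.
  refine (Nat.RecursiveIn.rfind h).of_eq fun m => ?_
  congr 1
  funext k
  have := he (m, k)
  simp only [encode_prod_val, encode_nat] at this
  simp [zeroJump, this]

theorem zeroJumpEnumerable_preimage_dom {α : Type} [Primcodable α] {F : ℕ →. ℕ}
    (hF : Nat.RecursiveIn {zeroJump} F) {g : α → ℕ} (hg : Computable g) :
    ZeroJumpEnumerable {a | (F (g a)).Dom} := by
  have h1 : Nat.RecursiveIn {zeroJump} fun n =>
      Part.bind (decode (α := α) n) fun a => Part.some (g a) :=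
    (Nat.Partrec.recursiveIn hg.partrec).of_eq fun n => by simp [Part.map_some]
  refine (recursiveIn_bind_pair (hF.comp h1) (Computable.const 0).to₂).of_eq fun n => ?_
  refine (congrArg (Part.map _) (Part.bind_assoc _ _ F)).trans ?_
  cases h : decode (α := α) n with
  | none => simp
  | some a =>
    refine (congrArg (Part.map _)
      ((Part.bind_some a fun x => (Part.some (g x)).bind F).trans (Part.bind_some (g a) F))).trans ?_
    refine Eq.trans ?_ (Part.bind_some a _).symm
    ext k
    simp only [Part.mem_map_iff, Part.mem_assert_iff, Part.mem_some_iff, Set.mem_ofPred_eq,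
      Part.dom_iff_mem, exists_prop]
    constructor
    · rintro ⟨x, hx, rfl⟩
      exact ⟨(), ⟨⟨x, hx⟩, trivial⟩, rfl⟩
    · rintro ⟨_, ⟨⟨x, hx⟩, -⟩, rfl⟩
      exact ⟨x, hx, rfl⟩

/-! ### Coding of stages and the iterated search -/

/-- The pair of a list of strings and a number with a given code. -/
def candidate (k : ℕ) : List (List Bool) × ℕ := (decode k).getD ([], 0)

theorem candidate_encode (D : List (List Bool) × ℕ) : candidate (encode D) = D := by
  simp [candidate]

theorem primrec_candidate : Primrec candidate :=
  Primrec.option_getD.comp Primrec.decode (Primrec.const _)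

/-- The list of strings enumerated after a stage, given the code of the stage and of the
selected candidate. -/
def extend (m k : ℕ) : ℕ :=
  encode ((candidate k).1 ++ (decode m.unpair.2.unpair.2 : Option (List (List Bool))).getD [])

theorem primrec_extend : Primrec₂ extend := by
  refine Primrec.encode.comp (Primrec.list_append.comp
    (Primrec.fst.comp (primrec_candidate.comp Primrec.snd)) ?_)
  refine Primrec.option_getD.comp (Primrec.decode.comp ?_) (Primrec.const _)
  exact Primrec.snd.comp (Primrec.unpair.comp
    (Primrec.snd.comp (Primrec.unpair.comp Primrec.fst)))

theorem extend_encode (I : Input) (i : ℕ) (w : List (List Bool)) (k : ℕ) :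
    extend (Nat.pair (encode I) (Nat.pair i (encode w))) k = encode ((candidate k).1 ++ w) := by
  simp [extend]

/-- The value is zero if the list with code `c` contains the string whose code is the second
component of `N`. -/
def lacks (N c : ℕ) : ℕ :=
  if ∃ x ∈ (decode N.unpair.2 : Option (List Bool)).toList,
    ∃ y ∈ (decode c : Option (List (List Bool))).getD [], y = x then 0 else 1

theorem primrec_lacks : Primrec₂ lacks := by
  refine Primrec.ite ?_ (Primrec.const 0) (Primrec.const 1)
  refine primrecPred_exists_mem (Primrec.optionToList.comp (Primrec.decode.comp
    (Primrec.snd.comp (Primrec.unpair.comp Primrec.fst)))) ?_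
  refine primrecPred_exists_mem (Primrec.option_getD.comp
    (Primrec.decode.comp (Primrec.snd.comp Primrec.fst)) (Primrec.const _)) ?_
  exact Primrec.eq.comp Primrec.snd (Primrec.snd.comp Primrec.fst)

theorem lacks_encode (I : Input) (x : List Bool) (w : List (List Bool)) :
    lacks (encode (I, x)) (encode w) = 0 ↔ x ∈ w := by
  simp [lacks]

/-- Iteration of a partial function of a parameter, the number of the iteration and the
current value. -/
def iteration (init : ℕ) (step : ℕ →. ℕ) (a n : ℕ) : Part ℕ :=
  n.rec (Part.some init) fun y IH => IH.bind fun i => step (Nat.pair a (Nat.pair y i))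

theorem recursiveIn_iteration {O : Set (ℕ →. ℕ)} {step : ℕ →. ℕ} (init : ℕ)
    (h : Nat.RecursiveIn O step) :
    Nat.RecursiveIn O fun q => iteration init step q.unpair.1 q.unpair.2 := by
  have hinit : Nat.RecursiveIn O (fun _ => Part.some init : ℕ →. ℕ) :=
    Nat.Partrec.recursiveIn (Partrec.nat_iff.1 (Computable.const _).partrec)
  exact hinit.prec h

theorem rePred_decode {α β : Type*} [Primcodable α] [Primcodable β] {p : α → β → Prop}
    (hp : REPred fun q : α × β => p q.1 q.2) {f : ℕ → β} (hf : Computable f) :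
    REPred fun q : ℕ × ℕ => ∃ s, (decode q.1 : Option α) = some s ∧ p s (f q.2) := by
  have hc : Partrec fun q : ℕ × ℕ => ((decode q.1 : Option α) : Part α) :=
    Computable.ofOption (Computable.decode.comp Computable.fst)
  have hg : Computable fun r : (ℕ × ℕ) × α => (r.2, f r.1.2) :=
    Computable.pair Computable.snd (hf.comp (Computable.snd.comp Computable.fst))
  have hc2 : Partrec₂ fun (q : ℕ × ℕ) (s : α) =>
      Part.assert (p s (f q.2)) fun _ => Part.some () := Partrec.comp hp hg
  refine (hc.bind hc2).dom_re.of_eq fun q => ?_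
  cases h : (decode q.1 : Option α) <;> simp [Part.assert]

open Classical in
/-- One stage of the construction: a search for a candidate that is not excluded. -/
noncomputable def searchStep (p : Stage → List (List Bool) × ℕ → Prop) : ℕ →. ℕ := fun m =>
  (Nat.rfind fun k => Part.some
    (decide ¬ ∃ s, (decode m : Option Stage) = some s ∧ p s (candidate k))).map fun k => extend m k

theorem recursiveIn_searchStep {p : Stage → List (List Bool) × ℕ → Prop}
    (hp : REPred fun q : Stage × List (List Bool) × ℕ => p q.1 q.2) :
    Nat.RecursiveIn {zeroJump} (searchStep p) := by
  classical
  exact recursiveIn_bind_pair (recursiveIn_zeroJump_search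
    (p := fun m k => ∃ s, (decode m : Option Stage) = some s ∧ p s (candidate k))
    (rePred_decode hp primrec_candidate.to_comp))
    primrec_extend.to_comp

theorem decode_stage (I : Input) (i : ℕ) (w : List (List Bool)) :
    (decode (Nat.pair (encode I) (Nat.pair i (encode w))) : Option Stage) = some (I, i, w) :=
  encodek (I, i, w)

theorem exists_of_mem_searchStep {p : Stage → List (List Bool) × ℕ → Prop} {I : Input} {i : ℕ}
    {w : List (List Bool)} {c : ℕ}
    (hc : c ∈ searchStep p (Nat.pair (encode I) (Nat.pair i (encode w)))) :
    ∃ D, ¬ p (I, i, w) D ∧ c = encode (D.1 ++ w) := by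
  classical
  obtain ⟨k, hk, rfl⟩ := (Part.mem_map_iff _).1 hc
  refine ⟨candidate k, ?_, extend_encode _ _ _ _⟩
  have := Nat.rfind_spec hk
  rw [Part.mem_some_iff, decode_stage, eq_comm, decide_eq_true_eq] at this
  exact fun h => this ⟨_, rfl, h⟩

theorem searchStep_dom {p : Stage → List (List Bool) × ℕ → Prop} {I : Input} {i : ℕ}
    {w : List (List Bool)} (h : ∃ D, ¬ p (I, i, w) D) :
    (searchStep p (Nat.pair (encode I) (Nat.pair i (encode w)))).Dom := by
  classical
  obtain ⟨D, hD⟩ := h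
  refine (rfind_decide_dom _).2 ⟨encode D, ?_⟩
  rw [decode_stage, candidate_encode]
  rintro ⟨s, hs, h⟩
  cases hs
  exact hD h

/-- An iterated search for candidates that are not excluded by an enumerable relation can be
carried out with oracle `0'`, and the strings collected on the way are `0'`-enumerable. -/
theorem exists_recursiveIn_iteration {p : Stage → List (List Bool) × ℕ → Prop}
    (hp : REPred fun q : Stage × List (List Bool) × ℕ => p q.1 q.2) :
    ∃ F : ℕ →. ℕ, Nat.RecursiveIn {zeroJump} F ∧
      ∀ (I : Input) (inv : ℕ → List (List Bool) → Prop), inv 0 [] →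
        (∀ i w, inv i w → ∃ D, ¬ p (I, i, w) D) →
        (∀ i w D, inv i w → ¬ p (I, i, w) D → inv (i + 1) (D.1 ++ w)) →
        ∃ w : ℕ → List (List Bool), (∀ i, inv i (w i)) ∧
          (∀ i, ∃ D, ¬ p (I, i, w i) D ∧ w (i + 1) = D.1 ++ w i) ∧
          ∀ x : List Bool, (F (encode (I, x))).Dom ↔ ∃ l, x ∈ w l := by
  let G := iteration (encode ([] : List (List Bool))) (searchStep p)
  have hT : Nat.RecursiveIn {zeroJump} fun q =>
      (G q.unpair.1.unpair.1 q.unpair.2).map fun c => lacks q.unpair.1 c := by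
    refine recursiveIn_bind_pair (g := fun q c => lacks q.unpair.1 c) ?_ ?_
    · refine (recursiveIn_comp_some
        (recursiveIn_iteration (encode ([] : List (List Bool))) (recursiveIn_searchStep hp))
        (Primrec₂.natPair.comp
          (Primrec.fst.comp (Primrec.unpair.comp (Primrec.fst.comp Primrec.unpair)))
          (Primrec.snd.comp Primrec.unpair)).to_comp).of_eq fun q => ?_
      simp [G]
    · exact (primrec_lacks.comp (Primrec.fst.comp (Primrec.unpair.comp Primrec.fst))
        Primrec.snd).to_comp
  -- Minimisation over `l` stops at the first zero of `lacks`, the first list containing `x`. The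
  -- iteration is defined at every `l`, so no earlier value blocks the search.
  refine ⟨_, hT.rfind, fun I inv h0 hex hinv => ?_⟩
  have hw : ∀ i, ∃ w, encode w ∈ G (encode I) i ∧ inv i w := by
    intro i
    induction i with
    | zero => exact ⟨[], Part.mem_some _, h0⟩
    | succ i ih =>
      obtain ⟨w, hw, hi⟩ := ih
      obtain ⟨c, hc⟩ := Part.dom_iff_mem.1 (searchStep_dom (hex i w hi))
      obtain ⟨D, hD, rfl⟩ := exists_of_mem_searchStep hc
      exact ⟨D.1 ++ w, Part.mem_bind hw hc, hinv i w D hi hD⟩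
  choose w hw hi using hw
  refine ⟨w, hi, fun i => ?_, fun x => ?_⟩
  · have h1 := hw (i + 1)
    obtain ⟨c, hc, h1⟩ := Part.mem_bind_iff.1 h1
    cases Part.mem_unique hc (hw i)
    obtain ⟨D, hD, h2⟩ := exists_of_mem_searchStep h1
    exact ⟨D, hD, encode_injective h2⟩
  · have h1 : ∀ l, (G (encode (I, x)).unpair.1 l) = Part.some (encode (w l)) := fun l => by
      rw [← Part.eq_some_iff.2 (hw l)]
      simp
    refine Nat.rfind_dom.trans ?_
    simp only [Nat.unpair_pair, h1, Part.map_some, lacks_encode, Part.map_eq_map,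
      Part.mem_some_iff, Part.some_dom, implies_true, and_true, eq_comm (a := true),
      decide_eq_true_eq]

/-! ### Correctness of the evidence -/

theorem openOf_append (v w : List (List Bool)) :
    openOf {x | x ∈ v ++ w} = openOf {x | x ∈ v} ∪ openOf {x | x ∈ w} := by
  ext ω
  simp [mem_openOf_iff, exists_or]

theorem covers_initial_iff {v : List (List Bool)} {L : ℕ} (hv : ∀ x ∈ v, x.length ≤ L)
    (ω : Cantor) : Covers v (initial ω L) ↔ ω ∈ openOf {x | x ∈ v} := by
  simp only [Covers, mem_openOf_iff, Set.mem_ofPred_eq]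
  constructor
  · rintro ⟨x, hx, h⟩
    rw [take_initial ω (hv x hx)] at h
    exact ⟨x.length, by rwa [h]⟩
  · rintro ⟨k, hk⟩
    refine ⟨_, hk, ?_⟩
    rw [length_initial, take_initial]
    simpa using hv _ hk

/-- No bound on the lengths in `v` is needed here: a string obtained by `take` from `L` bits has
length at most `L`. -/
theorem mem_openOf_of_covers {v : List (List Bool)} {L : ℕ} {ω : Cantor}
    (h : Covers v (initial ω L)) : ω ∈ openOf {x | x ∈ v} := by
  obtain ⟨x, hx, h⟩ := h
  have hl : x.length ≤ L := by
    have := congrArg List.length h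
    simp at this
    omega
  rw [take_initial ω hl] at h
  exact mem_openOf_iff.2 ⟨x.length, by simpa [h] using hx⟩

theorem Appears.mono {t t' : ℕ} (h : t ≤ t') {a : Code} {n : ℕ} {y : List Bool}
    (hy : Appears t a n y) : Appears t' a n y := by
  obtain ⟨j, hj, hs⟩ := hy
  obtain ⟨c, hc⟩ := Option.isSome_iff_exists.1 hs
  exact ⟨j, hj, Option.isSome_iff_exists.2 ⟨c, Code.evaln_mono h hc⟩⟩

theorem mem_level_of_appears {U : Set (ℕ × List Bool)} {a : Code} (ha : Enumerates a U)
    {t n L : ℕ} {ω : Cantor} (h : Appears t a n (initial ω L)) : ω ∈ level U n := by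
  obtain ⟨j, hj, hs⟩ := h
  obtain ⟨c, hc⟩ := Option.isSome_iff_exists.1 hs
  have hj' : j ≤ L := by simpa [Nat.lt_succ_iff] using hj
  rw [take_initial ω hj'] at hc
  exact mem_openOf_iff.2 ⟨j, (ha (n, initial ω j)).2
    (Part.dom_iff_mem.2 ⟨c, Code.evaln_sound hc⟩)⟩

theorem exists_appears {U : Set (ℕ × List Bool)} {a : Code} (ha : Enumerates a U)
    {n k L : ℕ} {ω : Cantor} (h : initial ω k ∈ {x | (n, x) ∈ U}) (hk : k ≤ L) :
    ∃ t, Appears t a n (initial ω L) := by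
  obtain ⟨c, hc⟩ := Part.dom_iff_mem.1 ((ha (n, initial ω k)).1 h)
  obtain ⟨t, ht⟩ := Code.evaln_complete.1 hc
  refine ⟨t, k, by simpa [Nat.lt_succ_iff] using hk, ?_⟩
  rw [take_initial ω hk]
  exact Option.isSome_iff_exists.2 ⟨c, ht⟩

theorem exists_length_le (v : List (List Bool)) : ∃ L, ∀ x ∈ v, x.length ≤ L := by
  induction v with
  | nil => exact ⟨0, by simp⟩
  | cons x v ih =>
    obtain ⟨L, hL⟩ := ih
    refine ⟨max x.length L, ?_⟩
    simp only [List.mem_cons, forall_eq_or_imp, le_max_iff, le_refl, true_or, true_and]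
    exact fun y hy => Or.inr (hL y hy)

/-- A common bound for the values of a monotone existential property on an initial segment. -/
theorem exists_uniform_bound {p : ℕ → ℕ → Prop} (hp : ∀ n t t', t ≤ t' → p n t → p n t') (m : ℕ)
    (h : ∀ n < m, ∃ t, p n t) : ∃ t, ∀ n < m, p n t := by
  choose! t ht using h
  exact ⟨(Finset.range m).sup t, fun n hn => hp n (t n) _
    (Finset.le_sup (Finset.mem_range.2 hn)) (ht n hn)⟩

/-- A string at least as long as all of `v` decides membership in [v], so its padding is a genuine
counterexample. Conversely, a point violating the inclusion supplies a prefix long enough for `v`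
and for the finitely many U_n. -/
theorem iInter_level_subset_iff {U : Set (ℕ × List Bool)} {a : Code} (ha : Enumerates a U)
    (i m : ℕ) (v : List (List Bool)) :
    (⋂ n ∈ Finset.Icc i m, level U n) ⊆ openOf {x | x ∈ v} ↔ ¬ ∃ t y, Escapes a i m v t y := by
  constructor
  · rintro h ⟨t, y, h1, h2⟩
    have h3 : padding y ∈ openOf {x | x ∈ v} := by
      refine h (Set.mem_iInter₂.2 fun n hn => ?_)
      rw [Finset.mem_Icc] at hn
      refine mem_level_of_appears ha (t := t) (L := y.length) ?_
      rw [initial_padding]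
      exact (h1 n (by omega)).resolve_left (by omega)
    rw [← covers_initial_iff (fun x hx => (h2 x hx).1), initial_padding] at h3
    obtain ⟨x, hx, h3⟩ := h3
    exact (h2 x hx).2 h3
  · intro h ω hω
    by_contra hv
    apply h
    have hω' : ∀ n < m + 1, ∃ k, n < i ∨ initial ω k ∈ {x | (n, x) ∈ U} := by
      intro n hn
      by_cases hi : n < i
      · exact ⟨0, Or.inl hi⟩
      · obtain ⟨k, hk⟩ := mem_openOf_iff.1
          (Set.mem_iInter₂.1 hω n (Finset.mem_Icc.2 ⟨by omega, by omega⟩))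
        exact ⟨k, Or.inr hk⟩
    choose! k hk using hω'
    obtain ⟨L, hL⟩ := exists_length_le v
    let M := max L ((Finset.range (m + 1)).sup k)
    obtain ⟨t, ht⟩ := exists_uniform_bound
      (p := fun n t => n < i ∨ Appears t a n (initial ω M))
      (fun n t t' h => Or.imp_right (Appears.mono h)) (m + 1) (fun n hn => by
        rcases hk n hn with h1 | h1
        · exact ⟨0, Or.inl h1⟩
        · obtain ⟨t, ht⟩ := exists_appears ha (L := M) h1
            (le_max_of_le_right (Finset.le_sup (Finset.mem_range.2 hn)))
          exact ⟨t, Or.inr ht⟩)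
    have hM : ∀ x ∈ v, x.length ≤ M := fun x hx => le_max_of_le_left (hL x hx)
    refine ⟨t, initial ω M, ht, fun x hx => ⟨by simpa using hM x hx, fun h1 => hv ?_⟩⟩
    exact mem_openOf_of_covers ⟨x, hx, h1⟩

/-! ### Measure bounds and their refutation -/

/-- The bound `(ε + i ε') / (i + 1)` for the measure at the stage `i`. -/
noncomputable def stageBound (e e' : ℕ × ℕ) (i : ℕ) : ℝ :=
  ((ratOf e : ℝ) + i * (ratOf e' : ℝ)) / (i + 1)

theorem exceeds_iff {a : Code} {e e' : ℕ × ℕ} {i n L t : ℕ} {v : List (List Bool)} :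
    Exceeds a e e' i v n L t ↔ stageBound e e' i < (countCovered a v n L t : ℝ) / 2 ^ L := by
  have h : stageBound e e' i =
      (e.1 * (e'.2 + 1) + i * (e'.1 * (e.2 + 1))) / ((i + 1) * ((e.2 + 1) * (e'.2 + 1))) := by
    simp only [stageBound, ratOf]
    push_cast
    field_simp
  rw [h, div_lt_div_iff₀ (by positivity) (by positivity), Exceeds]
  rw [← Nat.cast_lt (α := ℝ)]
  push_cast
  rfl

theorem stageBound_nonneg (e e' : ℕ × ℕ) (i : ℕ) : 0 ≤ stageBound e e' i := by
  simp only [stageBound, ratOf]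
  push_cast
  positivity

/-- The bound is a convex combination with weight i/(i+1) on ε', which grows with i. The strict gap
is the slack spent at a stage. -/
theorem stageBound_lt_succ {e e' : ℕ × ℕ} (h : ratOf e < ratOf e') (i : ℕ) :
    stageBound e e' i < stageBound e e' (i + 1) := by
  have h' : (ratOf e : ℝ) < ratOf e' := by exact_mod_cast h
  simp only [stageBound]
  push_cast
  rw [div_lt_div_iff₀ (by positivity) (by positivity)]
  nlinarith

theorem stageBound_le {e e' : ℕ × ℕ} (h : ratOf e < ratOf e') (i : ℕ) :
    stageBound e e' i ≤ ratOf e' := by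
  have h' : (ratOf e : ℝ) < ratOf e' := by exact_mod_cast h
  simp only [stageBound]
  rw [div_le_iff₀ (by positivity)]
  nlinarith

/-- Counts at any `L` and `t` bound the measure from below. They become exact once `L` dominates the
lengths involved and `t` is large enough for the finitely many strings of length `L`. -/
theorem coinMeasure_level_union_le_iff {U : Set (ℕ × List Bool)} {a : Code} (ha : Enumerates a U)
    {c : ℕ → ℕ} (hc : ∀ n x, (n, x) ∈ U → x.length ≤ c n) (e e' : ℕ × ℕ) (i n : ℕ)
    (v : List (List Bool)) :
    coinMeasure (level U n ∪ openOf {x | x ∈ v}) ≤ ENNReal.ofReal (stageBound e e' i) ↔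
      ¬ ∃ L t, Exceeds a e e' i v n L t := by
  simp only [exceeds_iff]
  constructor
  · rintro h ⟨L, t, hlt⟩
    rw [countCovered, ← ENNReal.ofReal_lt_ofReal_iff_of_nonneg (stageBound_nonneg e e' i),
      ← coinMeasure_filter_allStrings] at hlt
    refine (hlt.trans_le (measure_mono ?_)).not_ge h
    rintro ω (h1 | h1)
    · exact Or.inl (mem_level_of_appears ha h1)
    · exact Or.inr (mem_openOf_of_covers h1)
  · intro h
    obtain ⟨L₀, hL₀⟩ := exists_length_le v
    let L := max L₀ (c n)
    have hU : ∃ t, ∀ ω ∈ level U n, Appears t a n (initial ω L) := by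
      have hfin : Set.Finite {y : List Bool | y.length = L} := List.finite_length_eq Bool L
      -- A time is needed for every string; those that never appear get the dummy 0.
      have : ∀ y : List Bool, ∃ t, (∃ t', Appears t' a n y) → Appears t a n y := fun y => by
        by_cases hy : ∃ t', Appears t' a n y
        · exact hy.imp fun t ht _ => ht
        · exact ⟨0, fun h => (hy h).elim⟩
      choose t ht using this
      refine ⟨hfin.toFinset.sup t, fun ω hω => ?_⟩
      obtain ⟨k, hk⟩ := mem_openOf_iff.1 hω
      have hkc : k ≤ c n := by simpa using hc n _ hk
      exact (ht _ (exists_appears ha hk (hkc.trans (le_max_right _ _)))).mono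
        (Finset.le_sup (f := t) (by simp [L]))
    obtain ⟨t, ht⟩ := hU
    have h1 : coinMeasure (level U n ∪ openOf {x | x ∈ v}) ≤
        coinMeasure {ω | Appears t a n (initial ω L) ∨ Covers v (initial ω L)} := by
      refine measure_mono ?_
      rintro ω (h2 | h2)
      · exact Or.inl (ht ω h2)
      · exact Or.inr ((covers_initial_iff (fun x hx => le_max_of_le_left (hL₀ x hx)) ω).2 h2)
    refine h1.trans ?_
    rw [coinMeasure_filter_allStrings L fun y => Appears t a n y ∨ Covers v y]
    exact ENNReal.ofReal_le_ofReal (not_lt.1 fun h2 => h ⟨L, t, h2⟩)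

theorem not_exists_refutes_iff {U : Set (ℕ × List Bool)} {a b : Code} (ha : Enumerates a U)
    {c : ℕ → ℕ} (hc : ∀ n x, (n, x) ∈ U → x.length ≤ c n) (e e' : ℕ × ℕ) (i : ℕ)
    (w : List (List Bool)) (D : List (List Bool) × ℕ) :
    (¬ ∃ r, Refutes (((a, b), (e, e')), i, w) D r) ↔
      (⋂ n ∈ Finset.Icc i D.2, level U n) ⊆ openOf {x | x ∈ D.1 ++ w} ∧
      ∀ n ≥ i, coinMeasure (level U n ∪ openOf {x | x ∈ D.1 ++ w}) ≤
        ENNReal.ofReal (stageBound e e' (i + 1)) := by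
  simp only [iInter_level_subset_iff ha, coinMeasure_level_union_le_iff ha hc, Refutes]
  constructor
  · intro h
    -- Components of the evidence that the chosen disjunct ignores are filled arbitrarily.
    refine ⟨fun ⟨t, y, h1⟩ => h ⟨((t, y), 0, 0), Or.inl h1⟩, fun n hn ⟨L, t, h1⟩ => ?_⟩
    exact h ⟨((t, []), n, L), Or.inr ⟨Nat.lt_succ_of_le hn, h1⟩⟩
  · rintro ⟨h1, h2⟩ ⟨⟨⟨t, y⟩, n, L⟩, h | ⟨hn, h⟩⟩
    · exact h1 ⟨t, y, h⟩
    · exact h2 n (Nat.le_of_lt_succ hn) ⟨L, t, h⟩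

/-! ### Existence of a good extension -/

/-- A finite intersection of the sets `U_n` is generated by finitely many strings. -/
theorem exists_list_openOf_eq_iInter {U : Set (ℕ × List Bool)} {c : ℕ → ℕ}
    (hc : ∀ n x, (n, x) ∈ U → x.length ≤ c n) (i m : ℕ) :
    ∃ D : List (List Bool), openOf {x | x ∈ D} = ⋂ n ∈ Finset.Icc i m, level U n := by
  classical
  -- The first `L` bits decide membership in each of U_i, …, U_m.
  let L := (Finset.Icc i m).sup c
  refine ⟨(allStrings L).filter fun y => ∀ n ∈ Finset.Icc i m, ∃ j ≤ L, (n, y.take j) ∈ U, ?_⟩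
  ext ω
  simp only [mem_openOf_iff, Set.mem_ofPred_eq, List.mem_filter, mem_allStrings, length_initial,
    decide_eq_true_eq, Set.mem_iInter, level]
  constructor
  · rintro ⟨k, rfl, h⟩ n hn
    obtain ⟨j, hj, h⟩ := h n hn
    rw [take_initial ω hj] at h
    exact ⟨j, h⟩
  · intro h
    refine ⟨L, rfl, fun n hn => ?_⟩
    obtain ⟨k, hk⟩ := h n hn
    have hkL : k ≤ L := by
      have := hc n _ hk
      rw [length_initial] at this
      exact this.trans (Finset.le_sup hn)
    exact ⟨k, hkL, by rwa [take_initial ω hkL]⟩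

theorem exists_extension {U : Set (ℕ × List Bool)} {c : ℕ → ℕ}
    (hc : ∀ n x, (n, x) ∈ U → x.length ≤ c n) {i : ℕ} {w : List (List Bool)} {r r' : ℝ}
    (hr : 0 ≤ r) (hrr' : r < r')
    (hw : ∀ n ≥ i, coinMeasure (level U n ∪ openOf {x | x ∈ w}) ≤ ENNReal.ofReal r) :
    ∃ D : List (List Bool) × ℕ,
      (⋂ n ∈ Finset.Icc i D.2, level U n) ⊆ openOf {x | x ∈ D.1 ++ w} ∧
      ∀ n ≥ i, coinMeasure (level U n ∪ openOf {x | x ∈ D.1 ++ w}) ≤ ENNReal.ofReal r' := by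
  let B : ℕ → Set Cantor := fun m => ⋂ n ∈ Finset.Icc i m, level U n
  let K : Set Cantor := ⋂ n ≥ i, level U n
  have hUm : ∀ n, MeasurableSet (level U n) := fun n => measurableSet_openOf _
  have hBm : ∀ m, MeasurableSet (B m) := fun m => Finset.measurableSet_biInter _ fun n _ => hUm n
  have hKm : MeasurableSet K := MeasurableSet.biInter (Set.to_countable _) fun n _ => hUm n
  have hB : Antitone B := fun m m' h => Set.biInter_subset_biInter_left
    (Finset.coe_subset.2 (Finset.Icc_subset_Icc_right h))
  have hlim := tendsto_measure_iInter_atTop (μ := coinMeasure) (s := fun m => B m \ K)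
    (fun m => ((hBm m).diff hKm).nullMeasurableSet)
    (fun m m' h => Set.sdiff_subset_sdiff_left (hB h)) ⟨0, measure_ne_top _ _⟩
  have hempty : (⋂ m, B m \ K) = ∅ := by
    refine Set.eq_empty_iff_forall_notMem.2 fun ω hω => ?_
    rw [Set.mem_iInter] at hω
    refine (hω 0).2 (Set.mem_iInter₂.2 fun n hn => ?_)
    exact Set.mem_iInter₂.1 (hω n).1 n (Finset.mem_Icc.2 ⟨hn, le_rfl⟩)
  rw [hempty, measure_empty] at hlim
  obtain ⟨m, hm⟩ := (hlim.eventually_lt_const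
    (ENNReal.ofReal_pos.2 (sub_pos.2 hrr'))).exists
  obtain ⟨D, hD⟩ := exists_list_openOf_eq_iInter hc i m
  refine ⟨(D, m), ?_, fun n hn => ?_⟩
  · rw [openOf_append, hD]
    exact Set.subset_union_left
  · rw [openOf_append, hD]
    have hsub : level U n ∪ (B m ∪ openOf {x | x ∈ w}) ⊆
        (level U n ∪ openOf {x | x ∈ w}) ∪ (B m \ K) := by
      rintro ω (h | h | h)
      · exact Or.inl (Or.inl h)
      · by_cases hK : ω ∈ K
        · exact Or.inl (Or.inl (Set.mem_iInter₂.1 hK n hn))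
        · exact Or.inr ⟨h, hK⟩
      · exact Or.inl (Or.inr h)
    calc coinMeasure (level U n ∪ (B m ∪ openOf {x | x ∈ w}))
        ≤ coinMeasure (level U n ∪ openOf {x | x ∈ w}) + coinMeasure (B m \ K) :=
          (measure_mono hsub).trans (measure_union_le _ _)
      _ ≤ ENNReal.ofReal r + ENNReal.ofReal (r' - r) := add_le_add (hw n hn) hm.le
      _ = ENNReal.ofReal r' := by
          rw [← ENNReal.ofReal_add hr (sub_nonneg.2 hrr'.le)]
          congr 1
          ring

/-! ### Assembly of the covering set -/

theorem exists_uniform_cover :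
    ∃ F : ℕ →. ℕ, Nat.RecursiveIn {zeroJump} F ∧
      ∀ (U : Set (ℕ × List Bool)) (c : ℕ → ℕ) (a b : Code) (e e' : ℕ × ℕ),
        Enumerates a U →
        (∀ n x, (n, x) ∈ U → x.length ≤ c n) →
        (∀ n, coinMeasure (level U n) ≤ ENNReal.ofReal (ratOf e : ℝ)) →
        ratOf e < ratOf e' →
        let W := openOf {x | (F (encode ((((a, b), (e, e')), x) : Input × List Bool))).Dom}
        coinMeasure W ≤ ENNReal.ofReal (ratOf e' : ℝ) ∧ setLiminf (level U) ⊆ W := by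
  obtain ⟨F, hF, h⟩ := exists_recursiveIn_iteration (p := fun s D => ∃ r, Refutes s D r)
    (rePred_exists (p := fun (q : Stage × List (List Bool) × ℕ) r => Refutes q.1 q.2 r)
      primrec_refutes)
  refine ⟨F, hF, fun U c a b e e' ha hc hμ hee' => ?_⟩
  obtain ⟨w, hinv, hstep, hdom⟩ := h ((a, b), (e, e'))
    (fun i w => ∀ n ≥ i, coinMeasure (level U n ∪ openOf {x | x ∈ w}) ≤
      ENNReal.ofReal (stageBound e e' i))
    (fun n _ => by simpa [openOf, stageBound] using hμ n)
    (fun i w hw => by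
      simp only [not_exists_refutes_iff ha hc]
      exact exists_extension hc (stageBound_nonneg e e' i) (stageBound_lt_succ hee' i) hw)
    -- The stage controls all n ≥ i; the next invariant needs only n ≥ i + 1.
    (fun i w D _ hD n hn =>
      ((not_exists_refutes_iff ha hc e e' i w D).1 hD).2 n (Nat.le_of_succ_le hn))
  have hW : openOf {x | (F (encode ((((a, b), (e, e')), x) : Input × List Bool))).Dom} =
      ⋃ i, openOf {x | x ∈ w i} := by
    ext ω
    simp only [mem_openOf_iff, Set.mem_ofPred_eq, hdom, Set.mem_iUnion]
    exact exists_comm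
  have hmono : Monotone fun i => openOf {x | x ∈ w i} := by
    refine monotone_nat_of_le_succ fun i => ?_
    obtain ⟨D, -, hD⟩ := hstep i
    rw [hD, openOf_append]
    exact Set.subset_union_right
  intro W
  have hW' : W = ⋃ i, openOf {x | x ∈ w i} := hW
  rw [hW']
  constructor
  · rw [hmono.measure_iUnion]
    refine iSup_le fun i => ?_
    -- The invariant at n = i already bounds the measure of [w i].
    exact (measure_mono Set.subset_union_right).trans ((hinv i i le_rfl).trans
      (ENNReal.ofReal_le_ofReal (stageBound_le hee' i)))
  · intro ω hω
    obtain ⟨i, hi⟩ := Set.mem_iUnion.1 hω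
    obtain ⟨D, hD, hDw⟩ := hstep i
    refine Set.mem_iUnion.2 ⟨i + 1, ?_⟩
    rw [hDw]
    refine ((not_exists_refutes_iff ha hc e e' i (w i) D).1 hD).1
      (Set.mem_iInter₂.2 fun n hn => Set.mem_iInter₂.1 hi n (Finset.mem_Icc.1 hn).1)

theorem exists_ratOf_eq {q : ℚ} (hq : 0 ≤ q) : ∃ e, ratOf e = q := by
  -- `ratOf` adds 1 to the second component.
  refine ⟨(q.num.toNat, q.den - 1), ?_⟩
  have h1 : ((q.num.toNat : ℤ) : ℚ) = q.num := by
    rw [Int.toNat_of_nonneg (Rat.num_nonneg.2 hq)]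
  have h2 : ((q.den - 1 : ℕ) : ℚ) + 1 = q.den := by
    rw [← Nat.cast_succ, Nat.succ_eq_add_one, Nat.sub_add_cancel q.pos]
  rw [ratOf]
  simp only [h2]
  rw [← Int.cast_natCast, h1, Rat.num_div_den]

end LimitComplexity
open LimitComplexity in
/-- The second part says that the construction is uniform: a single `0'`-enumerable relation `A`
enumerates the strings of the covering set when given programs for `U` and `c` and the rational
numbers `ε` and `ε'`. -/
theorem theorem9 :
    (∀ (U : Set (ℕ × List Bool)) (c : ℕ → ℕ) (ε : ℚ) (ε' : ℝ),
      REPred (fun p : ℕ × List Bool => p ∈ U) →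
      Computable c →
      0 < ε →
      (∀ n x, (n, x) ∈ U → x.length ≤ c n) →
      (∀ n, coinMeasure (level U n) ≤ ENNReal.ofReal (ε : ℝ)) →
      (ε : ℝ) < ε' →
      ∃ W : Set Cantor,
        ZeroJumpEffectivelyOpen W ∧
        coinMeasure W ≤ ENNReal.ofReal ε' ∧
        setLiminf (level U) ⊆ W) ∧
    (∃ A : Set (Input × List Bool),
      ZeroJumpEnumerable A ∧
      ∀ (U : Set (ℕ × List Bool)) (c : ℕ → ℕ) (a b : Nat.Partrec.Code) (e e' : ℕ × ℕ),
        Enumerates a U →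
        Computes b c →
        0 < ratOf e →
        (∀ n x, (n, x) ∈ U → x.length ≤ c n) →
        (∀ n, coinMeasure (level U n) ≤ ENNReal.ofReal (ratOf e : ℝ)) →
        ratOf e < ratOf e' →
        coinMeasure (openOf {x | (((a, b), (e, e')), x) ∈ A}) ≤ ENNReal.ofReal (ratOf e' : ℝ) ∧
        setLiminf (level U) ⊆ openOf {x | (((a, b), (e, e')), x) ∈ A}) := by
  obtain ⟨F, hF, h⟩ := exists_uniform_cover
  refine ⟨fun U c ε ε' hU _ hε hc hμ hεε' => ?_, _,
    zeroJumpEnumerable_preimage_dom hF (Computable.encode (α := Input × List Bool)),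
    fun U c a b e e' ha _ _ hc hμ hee' => h U c a b e e' ha hc hμ hee'⟩
  obtain ⟨a, ha⟩ := exists_code_of_rePred hU
  -- Inputs carry rational bounds, so the real ε' is replaced by a rational between ε and ε'.
  obtain ⟨q, hq, hq'⟩ := exists_rat_btwn hεε'
  have hq0 : ε < q := by exact_mod_cast hq
  obtain ⟨e, rfl⟩ := exists_ratOf_eq hε.le
  obtain ⟨e', rfl⟩ := exists_ratOf_eq (hε.trans hq0).le
  -- The search never runs the second program, so any code can stand there.
  obtain ⟨h1, h2⟩ := h U c a Nat.Partrec.Code.zero e e' (fun p => (ha p).symm) hc hμ hq0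
  refine ⟨_, ⟨_, ?_, rfl⟩, h1.trans (ENNReal.ofReal_le_ofReal hq'.le), h2⟩
  exact zeroJumpEnumerable_preimage_dom hF
    (Computable.encode.comp (Computable.pair (Computable.const _) Computable.id))
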